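/- Let $n \ge 3$ and $d \ge 3$ be integers. Let $F_n$ be the free group with basis $x_1,\dots,x_n$, and let $H$ be its abelianization. For a group $G$ write $G^{\mathrm{ab}}$ for its abelianization, and $\mathrm{IA}(G)$ for the group of automorphisms of $G$ that act trivially on $G^{\mathrm{ab}}$; put $[x,y]=xyx^{-1}y^{-1}$. Automorphisms act from the right, and $x^\sigma$ denotes the image of $x$ under $\sigma$. Let $\mathcal K_n$ be the kernel of the Magnus representation $$r_M : \mathrm{IA}(F_n) \to \mathrm{GL}(n,\mathbb Z[H]), \qquad \sigma \mapsto \left(\overline{\frac{\partial x_i^{\sigma}}{\partial x_j}}\right)_{i,j},$$ where $\partial/\partial x_j$ are the Fox derivatives and the bar denotes the image under $\mathbb Z[F_n]\to\mathbb Z[H]$. Let $W_{n,d}$ be the kernel of the homomorphism from $F_n$ to the cyclic group of order $d$ that sends $x_1$ to a generator and $x_2,\dots,x_n$ to $1$. Every element of $\mathcal K_n$ maps $W_{n,d}$ onto itself and acts trivially on $W_{n,d}^{\mathrm{ab}}$; restriction to $W_{n,d}$ thus gives homomorphisms $$\pi_{n,d} : \mathcal K_n \to \mathrm{IA}(W_{n,d})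 \to \mathrm{IA}(W_{n,d})^{\mathrm{ab}}, \qquad \bar\pi_{n,d} : \mathcal K_n^{\mathrm{ab}} \to \mathrm{IA}(W_{n,d})^{\mathrm{ab}} .$$ For $2 \le m \le d-1$, $2 \le j,s \le n$ and $s \ne j$, let $\sigma_m^{j,s}\in\mathcal K_n$ be the automorphism of $F_n$ given by $$x_j \mapsto x_j\,[[x_1,x_s],[x_1^m,x_s]], \qquad x_i \mapsto x_i \quad (i \ne j).$$ Then the family of the elements $\pi_{n,d}(\sigma_m^{j,s})$, indexed by all such triples $(m,j,s)$, is linearly independent over $\mathbb Z$ in $\mathrm{IA}(W_{n,d})^{\mathrm{ab}}$. Hence $\mathcal K_n^{\mathrm{ab}}$ contains a free abelian subgroup of rank $(d-2)(n-1)(n-2)$ on which $\bar\pi_{n,d}$ is injective. -/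

import Mathlib

namespace MagnusKernel

noncomputable section

open scoped commutatorElement

/-! ### IA-automorphism groups -/

/-- The homomorphism `Aut G → Aut (G^ab)` induced by the abelianization of `G`. -/
def autAb (G : Type*) [Group G] : MulAut G →* MulAut (Abelianization G) where
  toFun σ := MulEquiv.abelianizationCongr σ
  map_one' := abelianizationCongr_refl
  map_mul' σ τ := (abelianizationCongr_trans τ σ).symm

/-- The IA-automorphism group of `G`: the automorphisms acting trivially on `G^ab`. -/
def IA (G : Type*) [Group G] : Subgroup (MulAut G) := (autAb G).ker

theorem mem_IA {G : Type*} [Group G] {σ : MulAut G} :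
    σ ∈ IA G ↔ ∀ x : G, Abelianization.of (σ x) = Abelianization.of x := by
  rw [IA, MonoidHom.mem_ker]
  constructor
  · intro h x
    exact DFunLike.congr_fun h (Abelianization.of x)
  · intro h
    ext y
    obtain ⟨x, rfl⟩ : ∃ x, Abelianization.of x = y := QuotientGroup.mk_surjective y
    exact h x

/-! ### Free groups and Fox derivatives -/

/-- The free group of rank `n`.  Its fixed basis `x_1, …, x_n` is
`FreeGroup.of 0, …, FreeGroup.of (n - 1)`. -/
abbrev F (n : ℕ) : Type := FreeGroup (Fin n)

/-- `H`, the abelianization of the free group `F n`. -/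
abbrev H (n : ℕ) : Type := Abelianization (F n)

/-- The Fox derivative of a word with respect to `x_i`: the letter `x_i` at a given place
contributes (prefix before it), the letter `x_i⁻¹` contributes -(prefix up to and including it). -/
def foxWord {n : ℕ} (i : Fin n) : List (Fin n × Bool) → MonoidAlgebra ℤ (F n)
  | [] => 0
  | (a, b) :: l =>
      (if a = i then
        (if b then 1 else - MonoidAlgebra.of ℤ (F n) (FreeGroup.of i)⁻¹) else 0)
        + MonoidAlgebra.of ℤ (F n) (FreeGroup.mk [(a, b)]) * foxWord i l

/-- The Fox derivative `∂w/∂x_i ∈ ℤ[F_n]` of an element `w` of the free group, computed from the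
reduced word of `w`. -/
def fox {n : ℕ} (i : Fin n) (w : F n) : MonoidAlgebra ℤ (F n) := foxWord i w.toWord

/-- The ring homomorphism `ℤ[F_n] → ℤ[H]` induced by the abelianization. -/
def abRing (n : ℕ) : MonoidAlgebra ℤ (F n) →+* MonoidAlgebra ℤ (H n) :=
  MonoidAlgebra.mapDomainRingHom ℤ (Abelianization.of : F n →* H n)

/-- The image of `∂w/∂x_i` in `ℤ[H]`. -/
def foxAb {n : ℕ} (i : Fin n) (w : F n) : MonoidAlgebra ℤ (H n) := abRing n (fox i w)

/-- The class of `w` in `H`, as an element of `ℤ[H]`. -/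
def cls {n : ℕ} (w : F n) : MonoidAlgebra ℤ (H n) :=
  MonoidAlgebra.of ℤ (H n) (Abelianization.of w)

theorem foxWord_append {n : ℕ} (i : Fin n) (l l' : List (Fin n × Bool)) :
    foxWord i (l ++ l') =
      foxWord i l + MonoidAlgebra.of ℤ (F n) (FreeGroup.mk l) * foxWord i l' := by
  induction l with
  | nil =>
    rw [← FreeGroup.one_eq_mk, map_one]
    simp [foxWord]
  | cons p l ih =>
    obtain ⟨a, b⟩ := p
    have h : (FreeGroup.mk ((a, b) :: l) : F n) = FreeGroup.mk [(a, b)] * FreeGroup.mk l := by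
      rw [FreeGroup.mul_mk]; rfl
    rw [List.cons_append, foxWord, foxWord, ih, h, map_mul, mul_add, mul_assoc, add_assoc]

theorem mk_false {n : ℕ} (a : Fin n) :
    (FreeGroup.mk [(a, false)] : F n) = (FreeGroup.of a)⁻¹ := rfl

theorem mk_true {n : ℕ} (a : Fin n) :
    (FreeGroup.mk [(a, true)] : F n) = FreeGroup.of a := rfl

theorem foxWord_step {n : ℕ} (i : Fin n) {l l' : List (Fin n × Bool)}
    (h : FreeGroup.Red.Step l l') : foxWord i l = foxWord i l' := by
  cases h with
  | @not L₁ L₂ a b =>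
    rw [foxWord_append, foxWord_append]
    congr 2
    cases b
    · simp only [foxWord, Bool.not_false, mk_true, mk_false, mul_add, ← mul_assoc, ← map_mul]
      by_cases hh : a = i <;> simp [hh, ← MonoidAlgebra.one_def]
    · simp only [foxWord, Bool.not_true, mk_true, mk_false, mul_add, ← mul_assoc, ← map_mul]
      by_cases hh : a = i
      · subst hh
        simp [MonoidAlgebra.single_mul_single, ← MonoidAlgebra.one_def]
      · simp [hh, ← MonoidAlgebra.one_def]

theorem foxWord_red {n : ℕ} (i : Fin n) {l l' : List (Fin n × Bool)}
    (h : FreeGroup.Red l l') : foxWord i l = foxWord i l' := by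
  induction h with
  | refl => rfl
  | tail _ h ih => exact ih.trans (foxWord_step i h)

theorem fox_mul {n : ℕ} (i : Fin n) (u v : F n) :
    fox i (u * v) = fox i u + MonoidAlgebra.of ℤ (F n) u * fox i v := by
  rw [fox, FreeGroup.toWord_mul, ← foxWord_red i FreeGroup.reduce.red, foxWord_append,
    FreeGroup.mk_toWord]
  rfl

theorem fox_of {n : ℕ} (i j : Fin n) : fox i (FreeGroup.of j) = if j = i then 1 else 0 := by
  simp [fox, foxWord]

theorem foxAb_mul {n : ℕ} (i : Fin n) (u v : F n) :
    foxAb i (u * v) = foxAb i u + cls u * foxAb i v := by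
  have h : abRing n (MonoidAlgebra.of ℤ (F n) u) = cls u := by simp [abRing, cls]
  rw [foxAb, fox_mul, map_add, map_mul, h]
  rfl

theorem foxAb_of {n : ℕ} (i j : Fin n) :
    foxAb i (FreeGroup.of j) = if j = i then 1 else 0 := by
  rw [foxAb, fox_of]
  split_ifs <;> simp

theorem cls_mul {n : ℕ} (u v : F n) : cls (u * v) = cls u * cls v := by
  simp only [cls, map_mul]

theorem cls_one {n : ℕ} : cls (1 : F n) = 1 := by
  simp only [cls, map_one]

theorem foxAb_one {n : ℕ} (i : Fin n) : foxAb i (1 : F n) = 0 := by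
  have h := foxAb_mul i (1 : F n) 1
  rw [mul_one, cls_one, one_mul] at h
  exact left_eq_add.mp h

theorem foxAb_inv {n : ℕ} (i : Fin n) (u : F n) :
    foxAb i u⁻¹ = - (cls u⁻¹ * foxAb i u) := by
  have h := foxAb_mul i u⁻¹ u
  rw [inv_mul_cancel, foxAb_one] at h
  exact eq_neg_of_add_eq_zero_left h.symm

theorem cls_IA {n : ℕ} (σ : IA (F n)) (w : F n) : cls (σ.1 w) = cls w := by
  rw [cls, cls, mem_IA.mp σ.2 w]

/-- The chain rule for IA-automorphisms. -/
theorem foxAb_apply {n : ℕ} (σ : IA (F n)) (j : Fin n) (w : F n) :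
    foxAb j (σ.1 w) = ∑ k, foxAb k w * foxAb j (σ.1 (FreeGroup.of k)) := by
  induction w using FreeGroup.induction_on with
  | C1 => simp [foxAb_one]
  | of x => simp [foxAb_of]
  | inv_of x ih =>
    rw [map_inv, foxAb_inv, ih, ← map_inv, cls_IA, Finset.mul_sum, ← Finset.sum_neg_distrib]
    refine Finset.sum_congr rfl fun k _ => ?_
    rw [foxAb_inv]
    ring
  | mul x y hx hy =>
    rw [map_mul, foxAb_mul, hx, hy, cls_IA, Finset.mul_sum, ← Finset.sum_add_distrib]
    refine Finset.sum_congr rfl fun k _ => ?_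
    rw [foxAb_mul]
    ring

/-! ### The Magnus representation and its kernel -/

/-- The Magnus representation `σ ↦ (∂(x_i^σ)/∂x_j)`, with entries in `ℤ[H]`.  Automorphisms act
from the right, so that the product of automorphisms is the opposite of the one of `MulAut`. -/
def magnusRep (n : ℕ) : (IA (F n))ᵐᵒᵖ →* GL (Fin n) (MonoidAlgebra ℤ (H n)) :=
  MonoidHom.toHomUnits
    { toFun := fun σ => Matrix.of fun i j => foxAb j (σ.unop.1 (FreeGroup.of i))
      map_one' := by
        ext1 i j
        simp [foxAb_of, Matrix.one_apply]
      map_mul' := fun σ τ => by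
        ext1 i j
        simp only [Matrix.of_apply, Matrix.mul_apply]
        exact foxAb_apply τ.unop j (σ.unop.1 (FreeGroup.of i)) }

/-- `K n`, the kernel of the Magnus representation, as a subgroup of the IA-automorphism group. -/
def K (n : ℕ) : Subgroup (IA (F n)) := (magnusRep n).ker.unop

theorem mem_K {n : ℕ} {σ : IA (F n)} :
    σ ∈ K n ↔ ∀ i j : Fin n, foxAb j (σ.1 (FreeGroup.of i)) = if i = j then 1 else 0 := by
  rw [K, Subgroup.mem_unop, MonoidHom.mem_ker, Units.ext_iff, ← Matrix.ext_iff]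
  simp only [Units.val_one, Matrix.one_apply]
  rfl

/-! ### Elements of the free group with vanishing Fox derivatives over `ℤ[H]` -/

/-- A set-theoretic section of `F n → H n`. -/
def sec {n : ℕ} (q : H n) : F n := Quotient.out q

theorem of_sec {n : ℕ} (q : H n) : Abelianization.of (sec q) = q := Quotient.out_eq q

theorem of_eq_one {G : Type*} [Group G] (x : G) :
    Abelianization.of x = 1 ↔ x ∈ commutator G := by
  rw [← MonoidHom.mem_ker, Abelianization.ker_of]

/-- The path in the covering with group `[F_n, F_n]` that starts at `q` and reads `w`, closed up
by the section. -/
def loop {n : ℕ} (q : H n) (w : F n) : Additive (Abelianization (commutator (F n))) :=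
  Additive.ofMul (Abelianization.of
    ⟨sec q * w * (sec (q * Abelianization.of w))⁻¹, by
      rw [← of_eq_one]; simp [of_sec]⟩)

theorem loop_mul {n : ℕ} (q : H n) (u v : F n) :
    loop q (u * v) = loop q u + loop (q * Abelianization.of u) v := by
  rw [loop, loop, loop, ← ofMul_mul, ← map_mul]
  congr 2
  apply Subtype.ext
  simp [mul_assoc]

theorem loop_one {n : ℕ} (q : H n) : loop q (1 : F n) = 0 := by
  have h := loop_mul q (1 : F n) 1
  simp only [mul_one, map_one] at h
  exact left_eq_add.mp h

theorem loop_inv {n : ℕ} (q : H n) (u : F n) :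
    loop q u⁻¹ = - loop (q * Abelianization.of u⁻¹) u := by
  have h := loop_mul q u⁻¹ u
  rw [inv_mul_cancel, loop_one] at h
  exact eq_neg_of_add_eq_zero_left h.symm

/-- The additive map `ℤ[H] → [F_n, F_n]^ab` with `q ↦ loop q x_i`. -/
def loopHom {n : ℕ} (i : Fin n) :
    MonoidAlgebra ℤ (H n) →+ Additive (Abelianization (commutator (F n))) :=
  (Finsupp.linearCombination ℤ fun q : H n => loop q (FreeGroup.of i)).toAddMonoidHom.comp
    MonoidAlgebra.coeffAddEquiv.toAddMonoidHom

theorem loopHom_of {n : ℕ} (i : Fin n) (q : H n) :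
    loopHom i (MonoidAlgebra.of ℤ (H n) q) = loop q (FreeGroup.of i) := by
  simp [loopHom]

theorem sum_loopHom {n : ℕ} (w : F n) : ∀ q : H n,
    ∑ i, loopHom i (MonoidAlgebra.of ℤ (H n) q * foxAb i w) = loop q w := by
  induction w using FreeGroup.induction_on with
  | C1 => intro q; simp [foxAb_one, loop_one]
  | of x =>
    intro q
    rw [← loopHom_of, Finset.sum_eq_single x]
    · simp [foxAb_of]
    · intro b _ hb
      simp [foxAb_of, hb.symm]
    · simp
  | inv_of x ih =>
    intro q
    rw [loop_inv, ← ih, ← Finset.sum_neg_distrib]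
    refine Finset.sum_congr rfl fun k _ => ?_
    rw [foxAb_inv, cls, mul_neg, map_neg, ← mul_assoc, ← map_mul]
  | mul x y hx hy =>
    intro q
    rw [loop_mul, ← hx, ← hy, ← Finset.sum_add_distrib]
    refine Finset.sum_congr rfl fun k _ => ?_
    rw [foxAb_mul, cls, mul_add, map_add, ← mul_assoc, ← map_mul]

theorem mem_of_foxAb_eq_zero {n : ℕ} {w : F n} (hw : w ∈ commutator (F n))
    (h : ∀ i, foxAb i w = 0) : w ∈ ⁅commutator (F n), commutator (F n)⁆ := by
  have h1 : loop (1 : H n) w = 0 := by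
    rw [← sum_loopHom]; simp [h]
  have h2 := (of_eq_one _).mp (ofMul_eq_zero.mp h1)
  have h3 := Subgroup.mem_map_of_mem (commutator (F n)).subtype h2
  rw [Subgroup.map_subtype_commutator] at h3
  have hw' : Abelianization.of w = 1 := (of_eq_one w).mpr hw
  simp only [Subgroup.subtype_apply, hw', mul_one] at h3
  have h4 := (inferInstance : (⁅commutator (F n), commutator (F n)⁆).Normal).conj_mem _ h3
    (sec (1 : H n))⁻¹
  simpa [mul_assoc] using h4

theorem foxAb_eq_zero_of_mem {n : ℕ} {w : F n}
    (h : w ∈ ⁅commutator (F n), commutator (F n)⁆) (i : Fin n) : foxAb i w = 0 := by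
  have hc : ∀ u ∈ commutator (F n), cls u = 1 := by
    intro u hu
    rw [cls, (of_eq_one u).mpr hu, map_one]
  rw [Subgroup.commutator_def] at h
  have hle : ∀ v ∈ Subgroup.closure
      {g : F n | ∃ g₁ ∈ commutator (F n), ∃ g₂ ∈ commutator (F n), ⁅g₁, g₂⁆ = g},
      cls v = 1 ∧ foxAb i v = 0 := by
    intro v hv
    induction hv using Subgroup.closure_induction with
    | mem x hx =>
      obtain ⟨a, ha, b, hb, rfl⟩ := hx
      have ha' := inv_mem ha
      have hb' := inv_mem hb
      refine ⟨hc _ (mul_mem (mul_mem (mul_mem ha hb) ha') hb'), ?_⟩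
      simp [commutatorElement_def, foxAb_mul, cls_mul, foxAb_inv, hc _ ha, hc _ hb,
        hc _ ha', hc _ hb']
    | one => exact ⟨cls_one, foxAb_one i⟩
    | mul x y _ _ hx hy =>
      exact ⟨by rw [cls_mul, hx.1, hy.1, one_mul], by rw [foxAb_mul, hx.2, hy.2]; simp⟩
    | inv x _ hx =>
      refine ⟨?_, by rw [foxAb_inv, hx.2]; simp⟩
      have := cls_mul x⁻¹ x
      rw [inv_mul_cancel, cls_one, hx.1, mul_one] at this
      exact this.symm
  exact (hle w h).2

theorem inv_mul_mem_of_mem_K {n : ℕ} {σ : IA (F n)} (hσ : σ ∈ K n) (w : F n) :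
    w⁻¹ * σ.1 w ∈ ⁅commutator (F n), commutator (F n)⁆ := by
  apply mem_of_foxAb_eq_zero
  · rw [← of_eq_one, map_mul, map_inv, mem_IA.mp σ.2 w, inv_mul_cancel]
  · intro i
    have : foxAb i (σ.1 w) = foxAb i w := by
      rw [foxAb_apply]
      simp [mem_K.mp hσ]
    rw [foxAb_mul, foxAb_inv, this]
    simp

/-! ### The subgroups `W n d` and the embedding of `K n` -/

/-- The homomorphism from `F n` to the cyclic group of order `d` sending `x_1` to the
generator and the other basis elements to the identity. -/
def iota (n d : ℕ) : F n →* Multiplicative (ZMod d) :=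
  FreeGroup.lift fun i : Fin n => if i.val = 0 then Multiplicative.ofAdd 1 else 1

/-- `W n d`, the kernel of `iota n d`. -/
def W (n d : ℕ) : Subgroup (F n) := (iota n d).ker

theorem commutator_le_W (n d : ℕ) : commutator (F n) ≤ W n d :=
  Abelianization.commutator_subset_ker (iota n d)

theorem IA_apply_mem_W {n : ℕ} (d : ℕ) {σ : MulAut (F n)} (hσ : σ ∈ IA (F n)) {w : F n}
    (hw : w ∈ W n d) : σ w ∈ W n d := by
  have h : w⁻¹ * σ w ∈ W n d := commutator_le_W n d (by
    rw [← of_eq_one, map_mul, map_inv, mem_IA.mp hσ w, inv_mul_cancel])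
  simpa using mul_mem hw h

/-- The action of the IA-automorphism group of `F n` on `W n d` by restriction. -/
def rho (n d : ℕ) : IA (F n) →* MulAut (W n d) where
  toFun σ :=
    { toFun := fun w => ⟨σ.1 w.1, IA_apply_mem_W d σ.2 w.2⟩
      invFun := fun w => ⟨σ.1⁻¹ w.1, IA_apply_mem_W d (inv_mem σ.2) w.2⟩
      left_inv := fun w => Subtype.ext (MulAut.inv_apply_self _ σ.1 w.1)
      right_inv := fun w => Subtype.ext (MulAut.apply_inv_self _ σ.1 w.1)
      map_mul' := fun u v => Subtype.ext (map_mul σ.1 u.1 v.1) }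
  map_one' := rfl
  map_mul' _ _ := rfl

theorem rho_mem_IA {n : ℕ} (d : ℕ) {σ : IA (F n)} (hσ : σ ∈ K n) :
    rho n d σ ∈ IA (W n d) := by
  rw [mem_IA]
  intro w
  have h1 : ((w⁻¹ * rho n d σ w : W n d) : F n) ∈ ⁅W n d, W n d⁆ :=
    Subgroup.commutator_mono (commutator_le_W n d) (commutator_le_W n d)
      (inv_mul_mem_of_mem_K hσ w.1)
  rw [← Subgroup.map_subtype_commutator] at h1
  obtain ⟨y, hy, hyw⟩ := h1
  have h2 : w⁻¹ * rho n d σ w ∈ commutator (W n d) := by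
    rwa [← Subtype.ext hyw]
  rw [← of_eq_one, map_mul, map_inv] at h2
  exact (inv_mul_eq_one.mp h2).symm

/-- The restriction homomorphism from `K n` to the IA-automorphism group of `W n d`. -/
def embK (n d : ℕ) : K n →* IA (W n d) :=
  ((rho n d).comp (K n).subtype).codRestrict (IA (W n d)) fun σ => rho_mem_IA d σ.2

/-- The homomorphism `K n → IA (W n d) → IA (W n d)^ab`. -/
def piK (n d : ℕ) : K n →* Abelianization (IA (W n d)) :=
  Abelianization.of.comp (embK n d)

/-- The homomorphism `(K n)^ab → IA (W n d)^ab` induced by `piK n d`, written additively. -/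
def piAb (n d : ℕ) :
    Additive (Abelianization (K n)) →+ Additive (Abelianization (IA (W n d))) :=
  MonoidHom.toAdditive (Abelianization.lift (piK n d))

/-! ### The automorphisms `σ_m^{j,s}` -/

/-- The first basis element `x_1` of a free group whose rank is seen to be positive from `j`. -/
def x₁ {n : ℕ} (j : Fin n) : F n := FreeGroup.of ⟨0, j.pos⟩

/-- The triples `(m, j, s)` with `2 ≤ m ≤ d - 1`, `2 ≤ j, s ≤ n` and `s ≠ j`.  An element of
`Fin n` with value `k` stands for the index `k + 1`. -/
structure Idx (n d : ℕ) where
  m : ℕ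
  j : Fin n
  s : Fin n
  two_le_m : 2 ≤ m
  m_lt : m < d
  j_ne : j.val ≠ 0
  s_ne : s.val ≠ 0
  s_ne_j : s ≠ j

/-- The element `[[x_1, x_s], [x_1^m, x_s]]`, with `[x, y] = x y x⁻¹ y⁻¹`. -/
def Idx.c {n d : ℕ} (p : Idx n d) : F n :=
  ⁅⁅x₁ p.s, FreeGroup.of p.s⁆, ⁅x₁ p.s ^ p.m, FreeGroup.of p.s⁆⁆

/-- The endomorphism `x_j ↦ x_j c`, `x_i ↦ x_i` for `i ≠ j`. -/
def transvection {n : ℕ} (j : Fin n) (c : F n) : F n →* F n :=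
  FreeGroup.lift fun i => if i = j then FreeGroup.of j * c else FreeGroup.of i

theorem transvection_c {n d : ℕ} (p : Idx n d) (c : F n) :
    transvection p.j c p.c = p.c := by
  have h1 : (⟨0, p.s.pos⟩ : Fin n) ≠ p.j := fun h => p.j_ne (by rw [← h])
  simp [transvection, Idx.c, x₁, map_commutatorElement, h1, p.s_ne_j]

theorem transvection_comp {n d : ℕ} (p : Idx n d) (c c' : F n)
    (hc : transvection p.j c c' = c') :
    (transvection p.j c).comp (transvection p.j c') = transvection p.j (c * c') := by
  ext i
  by_cases h : i = p.j
  · subst h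
    simp [transvection, mul_assoc] at hc ⊢
    exact hc
  · simp [transvection, h]

theorem transvection_one {n : ℕ} (j : Fin n) : transvection j 1 = MonoidHom.id (F n) := by
  ext i
  by_cases h : i = j <;> simp [transvection, h]

/-- The automorphism `σ_m^{j,s}` of `F n`:
`x_j ↦ x_j [[x_1, x_s], [x_1^m, x_s]]` and `x_i ↦ x_i` for `i ≠ j`. -/
def sigmaAut {n d : ℕ} (p : Idx n d) : MulAut (F n) :=
  MonoidHom.toMulEquiv (transvection p.j p.c) (transvection p.j p.c⁻¹)
    (by rw [transvection_comp p _ _ (transvection_c p _), inv_mul_cancel, transvection_one])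
    (by rw [transvection_comp p _ _ (by rw [map_inv, transvection_c]), mul_inv_cancel,
      transvection_one])

theorem sigmaAut_of {n d : ℕ} (p : Idx n d) (i : Fin n) :
    sigmaAut p (FreeGroup.of i) = if i = p.j then FreeGroup.of p.j * p.c else FreeGroup.of i := by
  simp [sigmaAut, transvection]

theorem c_mem {n d : ℕ} (p : Idx n d) : p.c ∈ ⁅commutator (F n), commutator (F n)⁆ :=
  Subgroup.commutator_mem_commutator
    (Subgroup.commutator_mem_commutator (Subgroup.mem_top _) (Subgroup.mem_top _))
    (Subgroup.commutator_mem_commutator (Subgroup.mem_top _) (Subgroup.mem_top _))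

theorem sigmaAut_mem_IA {n d : ℕ} (p : Idx n d) : sigmaAut p ∈ IA (F n) := by
  have hc : Abelianization.of p.c = 1 :=
    (of_eq_one _).mpr (Subgroup.commutator_le_left _ _ (c_mem p))
  have h : (Abelianization.of.comp (sigmaAut p).toMonoidHom : F n →* H n) =
      Abelianization.of := by
    ext i
    by_cases hi : i = p.j <;> simp [sigmaAut_of, hi, hc]
  exact mem_IA.mpr fun x => DFunLike.congr_fun h x

theorem sigmaAut_mem_K {n d : ℕ} (p : Idx n d) :
    (⟨sigmaAut p, sigmaAut_mem_IA p⟩ : IA (F n)) ∈ K n := by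
  rw [mem_K]
  intro i j
  simp only [sigmaAut_of]
  split_ifs with h1 h2 h2 <;>
    simp_all [foxAb_mul, foxAb_of, foxAb_eq_zero_of_mem (c_mem p)]

/-- `σ_m^{j,s}` as an element of the kernel of the Magnus representation. -/
def sigma {n d : ℕ} (p : Idx n d) : K n := ⟨⟨sigmaAut p, sigmaAut_mem_IA p⟩, sigmaAut_mem_K p⟩

end

end MagnusKernel

/-! It suffices to give, for each triple (m, j, s), an additive functional on IA(W)^ab that is 1 on
the class of its own automorphism and 0 on all others (`Idx.dual_apply`). Since [x_1^k, x_s] =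
(x_1^k x_s x_1^{-k}) x_s^{-1}, the element c = [[x_1, x_s], [x_1^m, x_s]] is visible in a class-two
quotient of W: a homomorphism f from W to the Heisenberg group taking the conjugates of x_s by x_1
and x_1^m to the two generators, and the other conjugates of basis elements to 1, sends c to the
central generator and kills the analogous element for any other (m, s). As the target has class two,
σ ↦ f(x_j⁻¹ σ(x_j)) is a homomorphism on IA(W) (`johnson`); its central coordinate is the
functional. No basis of W is needed: f is a coordinate of a homomorphism from F_n to a wreath
product with ℤ/d. -/

/-! ### The Heisenberg group and its center. -/

/-- The integral Heisenberg group. -/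
@[ext]
structure Heis where
  a : ℤ
  b : ℤ
  c : ℤ

open scoped commutatorElement

namespace Heis

instance : Mul Heis := ⟨fun x y => ⟨x.a + y.a, x.b + y.b, x.c + y.c + x.a * y.b⟩⟩
instance : One Heis := ⟨⟨0, 0, 0⟩⟩
instance : Inv Heis := ⟨fun x => ⟨-x.a, -x.b, -x.c + x.a * x.b⟩⟩

@[simp] theorem mul_a (x y : Heis) : (x * y).a = x.a + y.a := rfl
@[simp] theorem mul_b (x y : Heis) : (x * y).b = x.b + y.b := rfl
@[simp] theorem mul_c (x y : Heis) : (x * y).c = x.c + y.c + x.a * y.b := rfl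
@[simp] theorem one_a : (1 : Heis).a = 0 := rfl
@[simp] theorem one_b : (1 : Heis).b = 0 := rfl
@[simp] theorem one_c : (1 : Heis).c = 0 := rfl
@[simp] theorem inv_a (x : Heis) : (x⁻¹).a = -x.a := rfl
@[simp] theorem inv_b (x : Heis) : (x⁻¹).b = -x.b := rfl
@[simp] theorem inv_c (x : Heis) : (x⁻¹).c = -x.c + x.a * x.b := rfl

instance : Group Heis where
  mul_assoc x y z := by ext <;> simp <;> ring
  one_mul x := by ext <;> simp
  mul_one x := by ext <;> simp
  inv_mul_cancel x := by ext <;> simp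

theorem commutator_le_center : commutator Heis ≤ Subgroup.center Heis := by
  rw [commutator_def, Subgroup.commutator_le]
  intro x _ y _
  rw [Subgroup.mem_center_iff]
  intro z
  ext <;> simp [commutatorElement_def] <;> ring

/-- The last coordinate of a central element. -/
def centerCoord : Subgroup.center Heis →* Multiplicative ℤ where
  toFun x := Multiplicative.ofAdd x.1.c
  map_one' := rfl
  map_mul' x y := by
    -- Commuting with (0, 1, 0) forces a = 0, which removes the twist x.a * y.b from the product.
    have h := congrArg Heis.c (Subgroup.mem_center_iff.mp x.2 ⟨0, 1, 0⟩)
    have hx : x.1.a = 0 := by simpa using h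
    simp [hx, ← ofAdd_add]

theorem commutatorElement_basis : ⁅(⟨1, 0, 0⟩ : Heis), (⟨0, 1, 0⟩ : Heis)⁆ = ⟨0, 0, 1⟩ := by
  ext <;> simp [commutatorElement_def]

end Heis

namespace MagnusKernel

/-! ### Johnson homomorphisms into groups of class two. -/

theorem inv_mul_apply_mem_commutator {G : Type*} [Group G] {σ : MulAut G} (hσ : σ ∈ IA G) (w : G) :
    w⁻¹ * σ w ∈ commutator G := by
  rw [← of_eq_one, map_mul, map_inv, mem_IA.mp hσ w, inv_mul_cancel]

theorem map_mem_center {G N : Type*} [Group G] [Group N]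
    (hN : commutator N ≤ Subgroup.center N) (f : G →* N) {g : G} (hg : g ∈ commutator G) :
    f g ∈ Subgroup.center N :=
  hN <| (of_eq_one _).mp <| by
    rw [← Abelianization.map_of, (of_eq_one g).mpr hg, map_one]

/-- For a homomorphism `f` from `G` to a group of nilpotency class two, the IA-automorphisms of `G`
do not change the values of `f` on commutators. -/
theorem map_IA_eq_of_mem_commutator {G N : Type*} [Group G] [Group N]
    (hN : commutator N ≤ Subgroup.center N) (f : G →* N) {σ : MulAut G} (hσ : σ ∈ IA G) {g : G}
    (hg : g ∈ commutator G) : f (σ g) = f g := by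
  have hz (x : G) : ∃ z ∈ Subgroup.center N, f (σ x) = f x * z := by
    exact ⟨f (x⁻¹ * σ x), map_mem_center hN f (inv_mul_apply_mem_commutator hσ x), by simp⟩
  have hle : commutator G ≤ (f.comp σ.toMonoidHom).eqLocus f := by
    rw [commutator_def, Subgroup.commutator_le]
    intro x _ y _
    obtain ⟨z, hz1, hx⟩ := hz x
    obtain ⟨t, ht1, hy⟩ := hz y
    change f (σ ⁅x, y⁆) = f ⁅x, y⁆
    rw [map_commutatorElement, map_commutatorElement, map_commutatorElement, hx, hy]
    -- The central factors z and t drop out of the commutator: each is moved next to its inverse.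
    have h1 := Subgroup.mem_center_iff.mp hz1
    have h2 := Subgroup.mem_center_iff.mp ht1
    have h3 : ⁅f x * z, f y * t⁆ = f x * (z * (f y * t * z⁻¹)) * (f x)⁻¹ * (f y * t)⁻¹ := by
      simp [commutatorElement_def, mul_assoc]
    have h4 : f x * f y * t * (f x)⁻¹ * (t⁻¹ * (f y)⁻¹) =
        f x * f y * (t * ((f x)⁻¹ * t⁻¹)) * (f y)⁻¹ := by simp [mul_assoc]
    rw [h3, ← h1, inv_mul_cancel_right, mul_inv_rev, ← mul_assoc (f x), h4, ← h2,
      inv_mul_cancel_right, commutatorElement_def]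
  exact hle hg

/-- The homomorphism `σ ↦ f (w⁻¹ * σ w)` on IA-automorphisms, for a homomorphism `f` to a group of
nilpotency class two: a component of the first Johnson homomorphism. -/
def johnson {G N : Type*} [Group G] [Group N] (hN : commutator N ≤ Subgroup.center N)
    (f : G →* N) (w : G) : IA G →* Subgroup.center N where
  toFun σ := ⟨f (w⁻¹ * σ.1 w), map_mem_center hN f (inv_mul_apply_mem_commutator σ.2 w)⟩
  map_one' := Subtype.ext (by simp)
  map_mul' σ τ := Subtype.ext (by
    have h := map_IA_eq_of_mem_commutator hN f σ.2 (inv_mul_apply_mem_commutator τ.2 w)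
    -- The cocycle identity; it becomes additive because f does not see σ on the commutator w⁻¹
    -- τ(w).
    have h' : w⁻¹ * (σ * τ).1 w = w⁻¹ * σ.1 w * σ.1 (w⁻¹ * τ.1 w) := by simp
    change f (w⁻¹ * (σ * τ).1 w) = f (w⁻¹ * σ.1 w) * f (w⁻¹ * τ.1 w)
    rw [h', map_mul, h])

/-! ### Homomorphisms from W through wreath products. -/

theorem wreath_commutatorElement_inl {D Q : Type*} [Group D] [CommGroup Q] (q : Q) (g : Q → D) :
    ⁅(RegularWreathProduct.inl q : D ≀ᵣ Q), (⟨g, 1⟩ : D ≀ᵣ Q)⁆ = ⟨fun x => g (q⁻¹ * x) * (g x)⁻¹, 1⟩ := by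
  ext <;> simp [commutatorElement_def]

theorem wreath_commutatorElement {D Q : Type*} [Group D] [Group Q] (g h : Q → D) :
    ⁅(⟨g, 1⟩ : D ≀ᵣ Q), (⟨h, 1⟩ : D ≀ᵣ Q)⁆ = ⟨fun x => ⁅g x, h x⁆, 1⟩ := by
  ext <;> simp [commutatorElement_def]

/-- The homomorphism from the free group to a wreath product with the cyclic group of order `d`,
sending `x_1` to the generator and `x_i` to `g i` for `i ≠ 1`. -/
def wreathHom {D : Type*} [Group D] {n d : ℕ} (g : Fin n → Multiplicative (ZMod d) → D) :
    F n →* D ≀ᵣ Multiplicative (ZMod d) :=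
  FreeGroup.lift fun i : Fin n =>
    if i.val = 0 then RegularWreathProduct.inl (Multiplicative.ofAdd 1) else ⟨g i, 1⟩

theorem wreathHom_right {D : Type*} [Group D] {n d : ℕ} (g : Fin n → Multiplicative (ZMod d) → D)
    (w : F n) : (wreathHom g w).right = iota n d w := by
  have h : RegularWreathProduct.rightHom.comp (wreathHom g) = iota n d := by
    ext i
    by_cases hi : i.val = 0 <;> simp [wreathHom, iota, hi]
  exact DFunLike.congr_fun h w

/-- The coordinate at the identity of `wreathHom g`, restricted to `W n d`. -/
def wreathCoord {D : Type*} [Group D] {n d : ℕ} (g : Fin n → Multiplicative (ZMod d) → D) :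
    W n d →* D where
  toFun w := (wreathHom g w.1).left 1
  map_one' := by simp
  map_mul' u v := by
    -- On W the cyclic component is trivial, so multiplication does not shift coordinates.
    have h : (wreathHom g u.1).right = 1 := (wreathHom_right g u.1).trans u.2
    simp [h]

/-- The conjugate x_1^k x_s x_1^{-k} has the value of g at -k as its coordinate at the identity;
hence the arguments -1 and -m. -/
theorem wreathHom_c {D : Type*} [Group D] {n d : ℕ} (g : Fin n → Multiplicative (ZMod d) → D)
    (p : Idx n d) :
    (wreathHom g p.c).left 1 =
      ⁅g p.s (Multiplicative.ofAdd (-1)) * (g p.s 1)⁻¹,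
        g p.s (Multiplicative.ofAdd (-(p.m : ZMod d))) * (g p.s 1)⁻¹⁆ := by
  have h0 : wreathHom g (x₁ p.s) = RegularWreathProduct.inl (Multiplicative.ofAdd 1) := by
    simp [wreathHom, x₁]
  have hs : wreathHom g (FreeGroup.of p.s) = ⟨g p.s, 1⟩ := by
    simp [wreathHom, p.s_ne]
  rw [Idx.c, map_commutatorElement, map_commutatorElement, map_commutatorElement, map_pow, h0, hs,
    ← map_pow, wreath_commutatorElement_inl, wreath_commutatorElement_inl,
    wreath_commutatorElement]
  simp [← ofAdd_nsmul, ← ofAdd_neg]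

/-! ### The dual functionals. -/

/-- The values of the basis elements of `W n d` in the Heisenberg group: the conjugate of `x_s` by
`x_1` and the one by `x_1 ^ m` go to the two generators, all the other ones to the identity. -/
def Idx.heisVal {n d : ℕ} (p : Idx n d) (i : Fin n) (q : Multiplicative (ZMod d)) : Heis :=
  if i = p.s then
    if q = Multiplicative.ofAdd (-1) then ⟨1, 0, 0⟩
    else if q = Multiplicative.ofAdd (-(p.m : ZMod d)) then ⟨0, 1, 0⟩ else 1
  else 1

theorem natCast_inj_of_lt {d a b : ℕ} (ha : a < d) (hb : b < d) :
    (a : ZMod d) = b ↔ a = b := by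
  rw [ZMod.natCast_eq_natCast_iff', Nat.mod_eq_of_lt ha, Nat.mod_eq_of_lt hb]

theorem wreathHom_heisVal_c {n d : ℕ} (p q : Idx n d) :
    (wreathHom p.heisVal q.c).left 1 = if q.s = p.s ∧ q.m = p.m then ⟨0, 0, 1⟩ else 1 := by
  have hp := p.two_le_m
  have hq := q.two_le_m
  have hpd := p.m_lt
  have hqd := q.m_lt
  rw [wreathHom_c]
  by_cases hs : q.s = p.s
  · have h01 : (1 : Multiplicative (ZMod d)) ≠ Multiplicative.ofAdd (-1) := by
      intro h
      have h' : (0 : ZMod d) = -1 := h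
      have := (natCast_inj_of_lt (d := d) (a := 0) (b := 1) (by omega) (by omega)).mp (by
        simpa using congrArg Neg.neg h')
      omega
    have h0m : (1 : Multiplicative (ZMod d)) ≠ Multiplicative.ofAdd (-(p.m : ZMod d)) := by
      intro h
      have h' : (0 : ZMod d) = -p.m := h
      have := (natCast_inj_of_lt (d := d) (a := 0) (b := p.m) (by omega) (by omega)).mp (by
        simpa using congrArg Neg.neg h')
      omega
    have hm1 : Multiplicative.ofAdd (-(q.m : ZMod d)) ≠ Multiplicative.ofAdd (-1) := by
      intro h
      have h' : -(q.m : ZMod d) = -1 := h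
      have := (natCast_inj_of_lt (d := d) (a := q.m) (b := 1) (by omega) (by omega)).mp (by
        simpa using h')
      omega
    have hmm : Multiplicative.ofAdd (-(q.m : ZMod d)) = Multiplicative.ofAdd (-(p.m : ZMod d)) ↔
        q.m = p.m := by
      rw [← natCast_inj_of_lt hqd hpd, Multiplicative.ofAdd.injective.eq_iff, neg_inj]
    simp only [Idx.heisVal, hs, if_true, h01, h0m, hm1, hmm, if_false, inv_one, mul_one, true_and]
    split_ifs
    · exact Heis.commutatorElement_basis
    · simp
  · simp [Idx.heisVal, hs]

/-- The basis element `x_j` as an element of `W n d`. -/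
def Idx.xW {n d : ℕ} (p : Idx n d) : W n d :=
  ⟨FreeGroup.of p.j, by simp [W, MonoidHom.mem_ker, iota, p.j_ne]⟩

/-- The functional on `IA (W n d)^ab` dual to `σ_m^{j,s}`. -/
def Idx.dual {n d : ℕ} (p : Idx n d) : Additive (Abelianization (IA (W n d))) →+ ℤ :=
  MonoidHom.toAdditiveLeft (Abelianization.lift (Heis.centerCoord.comp
    (johnson Heis.commutator_le_center (wreathCoord p.heisVal) p.xW)))

theorem Idx.ext {n d : ℕ} {p q : Idx n d} (hm : p.m = q.m) (hj : p.j = q.j) (hs : p.s = q.s) :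
    p = q := by
  cases p; cases q; simp_all

theorem Idx.dual_apply {n d : ℕ} (p q : Idx n d) [Decidable (p = q)] :
    p.dual (Additive.ofMul (piK n d (sigma q))) = if p = q then 1 else 0 := by
  have h1 : p.dual (Additive.ofMul (piK n d (sigma q))) =
      -- If q.j = p.j the argument is q.c; otherwise the automorphism fixes x_j and the argument is
      -- 1.
      ((wreathHom p.heisVal ((FreeGroup.of p.j)⁻¹ * sigmaAut q (FreeGroup.of p.j))).left 1).c := rfl
  rw [h1, sigmaAut_of]
  by_cases hj : p.j = q.j
  · rw [if_pos hj, ← hj, inv_mul_cancel_left, wreathHom_heisVal_c]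
    by_cases h : p = q
    · simp [h]
    · have h' : ¬ (q.s = p.s ∧ q.m = p.m) := fun h' => h (Idx.ext h'.2.symm hj h'.1.symm)
      simp [h, h']
  · have h : p ≠ q := fun h => hj (by rw [h])
    simp [hj, h]

theorem linearIndependent_piK_sigma (n d : ℕ) :
    LinearIndependent ℤ (fun p : Idx n d =>
      (Additive.ofMul (piK n d (sigma p)) : Additive (Abelianization (IA (W n d))))) := by
  classical
  refine LinearIndependent.of_pairwise_dual_eq_zero_one _
    (fun p : Idx n d => p.dual.toIntLinearMap) (fun p q hpq => ?_) (fun p => ?_)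
  · exact (Idx.dual_apply p q).trans (if_neg hpq)
  · exact (Idx.dual_apply p p).trans (if_pos rfl)

/-! ### Counting the triples. -/

/-- The index set of the automorphisms `σ_m^{j,s}` as a product of finite sets. -/
def Idx.equivFinset (n d : ℕ) : Idx n d ≃
    (Finset.Ico 2 d ×ˢ (Finset.univ.filter fun i : Fin n => i.val ≠ 0).offDiag : Finset _) where
  toFun p := ⟨(p.m, p.s, p.j), by simp [p.two_le_m, p.m_lt, p.j_ne, p.s_ne, p.s_ne_j]⟩
  invFun x :=
    have h : (2 ≤ x.1.1 ∧ x.1.1 < d) ∧ x.1.2.1.val ≠ 0 ∧ x.1.2.2.val ≠ 0 ∧ x.1.2.1 ≠ x.1.2.2 := by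
      have := x.2
      simpa only [Finset.mem_product, Finset.mem_Ico, Finset.mem_offDiag, Finset.mem_filter,
        Finset.mem_univ, true_and] using this
    ⟨x.1.1, x.1.2.2, x.1.2.1, h.1.1, h.1.2, h.2.2.1, h.2.1, h.2.2.2⟩
  left_inv _ := rfl
  right_inv _ := rfl

theorem card_filter_val_ne_zero (n : ℕ) :
    (Finset.univ.filter fun i : Fin n => i.val ≠ 0).card = n - 1 := by
  cases n with
  | zero => rfl
  | succ k =>
    have h : (Finset.univ.filter fun i : Fin (k + 1) => i.val ≠ 0) = Finset.univ.erase 0 := by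
      ext i; simp [Fin.val_eq_zero_iff]
    rw [h, Finset.card_erase_of_mem (Finset.mem_univ _), Finset.card_univ, Fintype.card_fin]

/-- An enumeration of the index set. -/
noncomputable def Idx.equivFin (n d : ℕ) : Idx n d ≃ Fin ((d - 2) * (n - 1) * (n - 2)) :=
  (Idx.equivFinset n d).trans (Finset.equivFinOfCardEq (by
    -- With k = n - 1, the off-diagonal has k * k - k = k * (k - 1) pairs.
    rw [Finset.card_product, Nat.card_Ico, Finset.offDiag_card, card_filter_val_ne_zero, mul_assoc,
      ← Nat.mul_sub_one, Nat.sub_sub]))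

end MagnusKernel

/-! ### The free abelian subgroup. -/

open MagnusKernel in
theorem lemma4p1 (n d : ℕ) (hn : 3 ≤ n) (hd : 3 ≤ d) :
    LinearIndependent ℤ (fun p : MagnusKernel.Idx n d =>
      (Additive.ofMul (MagnusKernel.piK n d (MagnusKernel.sigma p)) :
        Additive (Abelianization (MagnusKernel.IA (MagnusKernel.W n d))))) ∧
    ∃ L : AddSubgroup (Additive (Abelianization (MagnusKernel.K n))),
      Nonempty (L ≃+ (Fin ((d - 2) * (n - 1) * (n - 2)) → ℤ)) ∧
      Set.InjOn (MagnusKernel.piAb n d) (L : Set (Additive (Abelianization (MagnusKernel.K n)))) := by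
  have hli := linearIndependent_piK_sigma n d
  let v : Idx n d → Additive (Abelianization (K n)) :=
    fun p => Additive.ofMul (Abelianization.of (sigma p))
  -- `piAb` sends the class of each σ to its `piK` image by definition. Independence of the images
  -- yields both independence upstairs and injectivity on the span.
  have hli' : LinearIndependent ℤ ((piAb n d).toIntLinearMap ∘ v) := hli
  have hv : LinearIndependent ℤ v := hli'.of_comp
  refine ⟨hli, (Submodule.span ℤ (Set.range v)).toAddSubgroup, ⟨?_⟩, ?_⟩
  · exact (hv.linearCombinationEquiv.symm.trans
      ((Finsupp.domLCongr (Idx.equivFin n d)).trans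
        (Finsupp.linearEquivFunOnFinite ℤ ℤ _))).toAddEquiv
  · intro x hx y hy hxy
    obtain ⟨a, rfl⟩ := Finsupp.mem_span_range_iff_exists_finsupp.mp hx
    obtain ⟨b, rfl⟩ := Finsupp.mem_span_range_iff_exists_finsupp.mp hy
    have key : a = b := hli' (by
      rw [Finsupp.linearCombination_linear_comp]
      exact hxy)
    rw [key]
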